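/- A binary word is a finite word over the alphabet $\{0,1\}$ (with $0<1$); its density is the number of $1$s it contains. A necklace is a word that is lexicographically smallest among all of its rotations, and a Lyndon word is a nonempty necklace that is strictly smaller than each of its non-trivial rotations (the rotations of a word of length $n$ by $i$ positions, $0<i<n$). Let $N(n,d)$ and $L(n,d)$ denote the number of binary necklaces and of binary Lyndon words, respectively, of length $n$ and density $d$. Let $n,d$ be natural numbers with $2<d<n-2$. Then $N(n,d)=L(n-1,d)+L(n-1,d-1)$ if and only if $$(n,d)\in\{(6,3),(7,3),(7,4),(8,4),(9,3),(9,6)\}.$$ -/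

import Mathlib

/-- A word is a necklace if it is lexicographically smallest among all its rotations. -/
def IsNecklace {α : Type*} [LinearOrder α] (w : List α) : Prop :=
  ∀ v : List α, w.IsRotated v → w ≤ v

/-- A Lyndon word is a nonempty necklace that is strictly smaller than each of its
non-trivial rotations. -/
def IsLyndon {α : Type*} [LinearOrder α] (w : List α) : Prop :=
  w ≠ [] ∧ IsNecklace w ∧ ∀ i : ℕ, 0 < i → i < w.length → w < w.rotate i

/-- The set of binary words (over the alphabet `{0, 1}`) of length `n` and density `d`,
the density being the number of `1`s. -/
def binaryWords (n d : ℕ) : Set (List (Fin 2)) :=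
  {w | w.length = n ∧ w.count 1 = d}

/-- The set of binary necklaces of length `n` and density `d`. -/
def necklaces (n d : ℕ) : Set (List (Fin 2)) :=
  {w ∈ binaryWords n d | IsNecklace w}

/-- The set of binary Lyndon words of length `n` and density `d`. -/
def lyndonWords (n d : ℕ) : Set (List (Fin 2)) :=
  {w ∈ binaryWords n d | IsLyndon w}

/-- The number `N(n,d)` of binary necklaces of length `n` and density `d`. -/
noncomputable def numNecklaces (n d : ℕ) : ℕ := (necklaces n d).ncard

/-- The number `L(n,d)` of binary Lyndon words of length `n` and density `d`. -/
noncomputable def numLyndonWords (n d : ℕ) : ℕ := (lyndonWords n d).ncard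

/-- There are only finitely many binary words of given length and density, so that the
cardinalities above are genuine. -/
theorem binaryWords_finite (n d : ℕ) : (binaryWords n d).Finite :=
  (List.finite_length_eq (Fin 2) n).subset fun _ hw => hw.1

/-! Every necklace is uniquely a power `u ^ j` of a Lyndon word, where `j` divides both length and
density. Counting necklaces, and counting all words by rotation class, gives N(n,d) = ∑ L(n/j, d/j)
and C(n,d) = ∑ (n/j) L(n/j, d/j) over j ∣ gcd(n,d) (`sum_necklaces_eq_sum_divisors`). So n N(n,d)
and n L(n,d) equal C(n,d) up to terms with j > 1. By Pascal's rule, multiplying N(n,d) and L(n-1,d)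
+ L(n-1,d-1) by n(n-1) gives main terms (n-1) C(n,d) and n C(n,d). Hence N is strictly smaller once
the corrections stay below C(n,d) (`numNecklaces_lt_of_properPowerSum_lt`). The symmetry d ↦ n - d
reduces to 2d ≤ n. There the corrections are small except at (6,3), (7,3), (8,4), (9,3), where
equality is computed: d = 3 is done by hand, n ≥ 62 by `lt_chooseRatio`, and the rest by evaluation.
-/

/-! ### Rotation periods and powers of words -/

section Rotation

variable {α : Type*}

/-- Cyclic rotation of a word by one position. -/
def rotateOne (w : List α) : List α := w.rotate 1

theorem iterate_rotateOne (k : ℕ) (w : List α) : rotateOne^[k] w = w.rotate k := by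
  induction k with
  | zero => simp
  | succ k ih => rw [Function.iterate_succ_apply', ih, rotateOne, List.rotate_rotate]

/-- The least positive number of rotations that fixes a word. -/
noncomputable def rotationPeriod (w : List α) : ℕ := Function.minimalPeriod rotateOne w

theorem rotate_eq_self_iff_rotationPeriod_dvd {w : List α} {k : ℕ} :
    w.rotate k = w ↔ rotationPeriod w ∣ k := by
  rw [rotationPeriod, ← Function.isPeriodicPt_iff_minimalPeriod_dvd, Function.IsPeriodicPt,
    Function.IsFixedPt, iterate_rotateOne]

theorem rotationPeriod_dvd_length (w : List α) : rotationPeriod w ∣ w.length :=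
  rotate_eq_self_iff_rotationPeriod_dvd.1 w.rotate_length

theorem rotate_mod_rotationPeriod (w : List α) (k : ℕ) :
    w.rotate (k % rotationPeriod w) = w.rotate k := by
  simp only [← iterate_rotateOne]
  exact Function.iterate_mod_minimalPeriod_eq

theorem rotate_injOn_rotationPeriod (w : List α) :
    (Set.Iio (rotationPeriod w)).InjOn fun k => w.rotate k := by
  simp only [← iterate_rotateOne]
  exact Function.iterate_injOn_Iio_minimalPeriod

/-- The concatenation of `j` copies of a word. -/
def wordPow (u : List α) (j : ℕ) : List α := (List.replicate j u).flatten

theorem wordPow_succ (u : List α) (j : ℕ) : wordPow u (j + 1) = u ++ wordPow u j := by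
  simp [wordPow, List.replicate_succ]

theorem length_wordPow (u : List α) (j : ℕ) : (wordPow u j).length = j * u.length := by
  simp [wordPow]

theorem count_wordPow [DecidableEq α] (u : List α) (j : ℕ) (a : α) :
    (wordPow u j).count a = j * u.count a := by
  simp [wordPow, List.count_flatten]

theorem wordPow_append_comm (s t : List α) (j : ℕ) :
    t ++ wordPow (s ++ t) j = wordPow (t ++ s) j ++ t := by
  induction j with
  | zero => simp [wordPow]
  | succ j ih => simp only [wordPow_succ, List.append_assoc, ih]

theorem rotateOne_wordPow (u : List α) (j : ℕ) :
    rotateOne (wordPow u j) = wordPow (rotateOne u) j := by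
  rcases u with _ | ⟨a, t⟩
  · simp [rotateOne, wordPow]
  rcases j with _ | j
  · simp [rotateOne, wordPow]
  have h := wordPow_append_comm [a] t j
  simp only [List.singleton_append] at h
  simp only [rotateOne, wordPow_succ, List.cons_append, List.rotate_cons_succ, List.rotate_zero]
  rw [h, List.append_assoc]
  simpa using (wordPow_append_comm [] (t ++ [a]) j).symm

theorem rotate_wordPow (u : List α) (j k : ℕ) :
    (wordPow u j).rotate k = wordPow (u.rotate k) j := by
  simp only [← iterate_rotateOne]
  exact ((Function.Semiconj.iterate_right (f := fun u => wordPow u j)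
    (fun u => (rotateOne_wordPow u j).symm) k) u).symm

theorem wordPow_inj {u v : List α} {j : ℕ} (hj : j ≠ 0) (h : wordPow u j = wordPow v j) :
    u = v := by
  have hlen := congrArg List.length h
  rw [length_wordPow, length_wordPow] at hlen
  have hl : u.length = v.length := Nat.eq_of_mul_eq_mul_left (Nat.pos_of_ne_zero hj) hlen
  obtain ⟨j, rfl⟩ := Nat.exists_eq_succ_of_ne_zero hj
  rw [Nat.succ_eq_add_one, wordPow_succ, wordPow_succ] at h
  exact (List.append_inj h hl).1

theorem rotationPeriod_wordPow (u : List α) {j : ℕ} (hj : j ≠ 0) :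
    rotationPeriod (wordPow u j) = rotationPeriod u := by
  apply Nat.dvd_antisymm
  · rw [← rotate_eq_self_iff_rotationPeriod_dvd, rotate_wordPow,
      rotate_eq_self_iff_rotationPeriod_dvd.2 dvd_rfl]
  · rw [← rotate_eq_self_iff_rotationPeriod_dvd]
    apply wordPow_inj hj
    rw [← rotate_wordPow, rotate_eq_self_iff_rotationPeriod_dvd.2 dvd_rfl]

/-- If `u` and `v` commute, the shorter `u` is a prefix of `v`; cancelling it leaves a word that
still commutes with `u`. -/
theorem eq_wordPow_of_append_comm (u : List α) (hu : u ≠ []) :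
    ∀ (j : ℕ) (v : List α), v.length = j * u.length → u ++ v = v ++ u → v = wordPow u j
  | 0, v, hl, _ => by
    rw [List.eq_nil_of_length_eq_zero (l := v) (by simpa using hl)]
    rfl
  | j + 1, v, hl, hc => by
    have hle : u.length ≤ v.length := by rw [hl]; nlinarith
    obtain ⟨v', rfl⟩ : u <+: v :=
      List.prefix_of_prefix_length_le (List.prefix_append u v) (hc ▸ List.prefix_append v u) hle
    rw [wordPow_succ]
    rw [List.append_assoc] at hc
    have hc' := List.append_cancel_left hc
    rw [← eq_wordPow_of_append_comm u hu j v' (by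
      simp only [List.length_append] at hl; linarith) hc']

/-- Invariance under rotation by `p` says that the prefix of length `p` commutes with the remaining
suffix. -/
theorem eq_wordPow_take {w : List α} {p j : ℕ} (hl : w.length = j * p) (hp : p ≠ 0)
    (hr : w.rotate p = w) : w = wordPow (w.take p) j := by
  rcases j with _ | j
  · rw [List.eq_nil_of_length_eq_zero (l := w) (by simpa using hl)]
    rfl
  have hle : p ≤ w.length := by rw [hl]; nlinarith
  have hlen : (w.take p).length = p := by simp [hle]
  rw [wordPow_succ, ← eq_wordPow_of_append_comm (w.take p) (by
    intro h; rw [h] at hlen; exact hp hlen.symm) j (w.drop p), List.take_append_drop]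
  · rw [List.length_drop, hlen, hl, Nat.succ_mul, Nat.add_sub_cancel]
  · rw [List.take_append_drop, ← List.rotate_eq_drop_append_take hle, hr]

end Rotation

/-! ### Necklaces, Lyndon words and rotation classes -/

section Necklaces

variable {α : Type*} [LinearOrder α]

theorem isNecklace_iff_forall_rotate {w : List α} : IsNecklace w ↔ ∀ k, w ≤ w.rotate k :=
  ⟨fun h k => h _ ⟨k, rfl⟩, fun h _ ⟨k, hk⟩ => hk ▸ h k⟩

theorem append_lt_append_of_lt {u v : List α} (hl : u.length = v.length) (h : u < v)
    (x y : List α) : u ++ x < v ++ y := by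
  induction u generalizing v with
  | nil =>
    rw [List.eq_nil_of_length_eq_zero hl.symm] at h
    exact absurd h (lt_irrefl _)
  | cons a u ih =>
    rcases v with _ | ⟨b, v⟩
    · simp at hl
    rw [List.cons_lt_cons_iff] at h
    rw [List.cons_append, List.cons_append, List.cons_lt_cons_iff]
    exact h.imp_right fun h => ⟨h.1, ih (by simpa using hl) h.2⟩

theorem wordPow_le_wordPow_iff {u v : List α} (hl : u.length = v.length) {j : ℕ} (hj : j ≠ 0) :
    wordPow u j ≤ wordPow v j ↔ u ≤ v := by
  obtain ⟨j, rfl⟩ := Nat.exists_eq_succ_of_ne_zero hj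
  rcases lt_trichotomy u v with h | rfl | h
  · refine iff_of_true (le_of_lt ?_) h.le
    simp only [Nat.succ_eq_add_one, wordPow_succ]
    exact append_lt_append_of_lt hl h _ _
  · simp
  · refine iff_of_false (not_le_of_gt ?_) (not_le_of_gt h)
    simp only [Nat.succ_eq_add_one, wordPow_succ]
    exact append_lt_append_of_lt hl.symm h _ _

theorem isNecklace_wordPow_iff {u : List α} {j : ℕ} (hj : j ≠ 0) :
    IsNecklace (wordPow u j) ↔ IsNecklace u := by
  simp only [isNecklace_iff_forall_rotate, rotate_wordPow]
  exact forall_congr' fun k => wordPow_le_wordPow_iff (by simp) hj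

/-- No rotation of a necklace is smaller than it, so strictness only excludes rotations equal to the
word. -/
theorem isLyndon_iff {w : List α} :
    IsLyndon w ↔ w ≠ [] ∧ IsNecklace w ∧ rotationPeriod w = w.length := by
  refine and_congr_right fun hw => and_congr_right fun hn => ⟨fun h => ?_, fun h i hi hil => ?_⟩
  · have hpos := List.length_pos_iff.2 hw
    refine le_antisymm (Nat.le_of_dvd hpos (rotationPeriod_dvd_length w)) ?_
    by_contra! hlt
    have := h _ (Nat.pos_of_dvd_of_pos (rotationPeriod_dvd_length w) hpos) hlt
    rw [rotate_eq_self_iff_rotationPeriod_dvd.2 dvd_rfl] at this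
    exact lt_irrefl _ this
  · refine lt_of_le_of_ne (isNecklace_iff_forall_rotate.1 hn i) fun he => ?_
    have := Nat.le_of_dvd hi (rotate_eq_self_iff_rotationPeriod_dvd.1 he.symm)
    omega

theorem exists_isNecklace_isRotated (w : List α) : ∃ v, IsNecklace v ∧ w.IsRotated v := by
  obtain ⟨v, hv, hmin⟩ := w.cyclicPermutations.toFinset.exists_minimal
    ⟨w, by simp [List.IsRotated.refl]⟩
  simp only [List.mem_toFinset, List.mem_cyclicPermutations_iff] at hv hmin
  refine ⟨v, fun x hx => ?_, hv.symm⟩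
  exact (le_total v x).elim id fun h => hmin (hx.symm.trans hv) h

theorem IsNecklace.eq_of_isRotated {v w : List α} (hv : IsNecklace v) (hw : IsNecklace w)
    (h : v.IsRotated w) : v = w :=
  le_antisymm (hv w h) (hw v h.symm)

/-- The necklace among the rotations of a word. -/
noncomputable def necklaceOf (w : List α) : List α := (exists_isNecklace_isRotated w).choose

theorem isNecklace_necklaceOf (w : List α) : IsNecklace (necklaceOf w) :=
  (exists_isNecklace_isRotated w).choose_spec.1

theorem isRotated_necklaceOf (w : List α) : w.IsRotated (necklaceOf w) :=
  (exists_isNecklace_isRotated w).choose_spec.2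

theorem necklaceOf_eq_iff {v w : List α} (hv : IsNecklace v) :
    necklaceOf w = v ↔ w.IsRotated v :=
  ⟨fun h => h ▸ isRotated_necklaceOf w, fun h =>
    (isNecklace_necklaceOf w).eq_of_isRotated hv ((isRotated_necklaceOf w).symm.trans h)⟩

end Necklaces

/-! ### Counting by rotation class -/

section Counting

theorem mem_binaryWords_of_isRotated {n d : ℕ} {v w : List (Fin 2)} (h : v.IsRotated w)
    (hw : w ∈ binaryWords n d) : v ∈ binaryWords n d :=
  ⟨h.perm.length_eq.trans hw.1, (h.perm.count_eq 1).trans hw.2⟩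

theorem ncard_binaryWords (n d : ℕ) : (binaryWords n d).ncard = n.choose d := by
  induction n generalizing d with
  | zero =>
    rcases d with _ | d
    · rw [Set.ncard_eq_one.2 ⟨[], ?_⟩, Nat.choose_self]
      ext w
      simp only [binaryWords, List.length_eq_zero_iff, Set.mem_ofPred_eq, Set.mem_singleton_iff]
      exact ⟨fun h => h.1, fun h => by simp [h]⟩
    · rw [Nat.choose_zero_succ, Set.ncard_eq_zero (binaryWords_finite _ _)]
      ext w
      simp only [binaryWords, List.length_eq_zero_iff, Set.mem_ofPred_eq, Set.mem_empty_iff_false,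
        iff_false]
      rintro ⟨rfl, h⟩
      simp at h
  | succ n ih =>
    have key : ∀ (a : Fin 2) (s : Set (List (Fin 2))), (List.cons a '' s).ncard = s.ncard :=
      fun a s => Set.ncard_image_of_injective s (List.cons_injective)
    rcases d with _ | d
    · refine Eq.trans (congrArg Set.ncard ?_)
        ((key 0 (binaryWords n 0)).trans ((ih 0).trans (by simp)))
      ext w
      rcases w with _ | ⟨a, w⟩
      · simp [binaryWords]
      · fin_cases a <;> simp [binaryWords]
    · rw [Nat.choose_succ_succ, ← ih d, ← ih (d + 1), ← key 1 (binaryWords n d),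
        ← key 0 (binaryWords n (d + 1)), ← Set.ncard_union_eq ?_ ((binaryWords_finite _ _).image _)
          ((binaryWords_finite _ _).image _)]
      · congr 1
        ext w
        rcases w with _ | ⟨a, w⟩
        · simp [binaryWords]
        · fin_cases a <;> simp [binaryWords]
      · rw [Set.disjoint_left]
        rintro _ ⟨x, -, rfl⟩ ⟨y, -, h⟩
        simp at h

theorem necklaces_finite (n d : ℕ) : (necklaces n d).Finite :=
  (binaryWords_finite n d).subset fun _ h => h.1

/-- The fibre of `necklaceOf` over a necklace is its rotation class, whose size is the period. -/
theorem choose_eq_sum_rotationPeriod (n d : ℕ) (hn : n ≠ 0) :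
    n.choose d = ∑ w ∈ (necklaces_finite n d).toFinset, rotationPeriod w := by
  classical
  rw [← ncard_binaryWords, Set.ncard_eq_toFinset_card _ (binaryWords_finite n d)]
  rw [Finset.card_eq_sum_card_fiberwise (f := necklaceOf) (t := (necklaces_finite n d).toFinset)]
  · refine Finset.sum_congr rfl fun v hv => ?_
    rw [Set.Finite.mem_toFinset] at hv
    have himg : (binaryWords_finite n d).toFinset.filter (fun w => necklaceOf w = v) =
        (Finset.range (rotationPeriod v)).image fun k => v.rotate k := by
      ext w
      simp only [Finset.mem_filter, Set.Finite.mem_toFinset, Finset.mem_image, Finset.mem_range,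
        necklaceOf_eq_iff hv.2]
      constructor
      · rintro ⟨-, h⟩
        obtain ⟨k, rfl⟩ := h.symm
        refine ⟨k % rotationPeriod v, Nat.mod_lt _ ?_, rotate_mod_rotationPeriod v k⟩
        refine Nat.pos_of_dvd_of_pos (rotationPeriod_dvd_length v) ?_
        rw [hv.1.1]
        exact Nat.pos_of_ne_zero hn
      · rintro ⟨k, -, rfl⟩
        have : (v.rotate k).IsRotated v := List.IsRotated.forall v k
        exact ⟨mem_binaryWords_of_isRotated this hv.1, this⟩
    rw [himg, Finset.card_image_of_injOn, Finset.card_range]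
    rw [Finset.coe_range]
    exact rotate_injOn_rotationPeriod v
  · intro w hw
    simp only [Set.Finite.coe_toFinset] at hw ⊢
    exact ⟨mem_binaryWords_of_isRotated (isRotated_necklaceOf w).symm hw, isNecklace_necklaceOf w⟩

/-- The bijection is `u ↦ wordPow u j`; its inverse takes the prefix of length `m`. -/
theorem ncard_necklaces_rotationPeriod {m e j : ℕ} (hm : m ≠ 0) (hj : j ≠ 0) :
    {w ∈ necklaces (j * m) (j * e) | rotationPeriod w = m}.ncard = numLyndonWords m e := by
  rw [numLyndonWords, ← Set.ncard_image_of_injective (f := fun u => wordPow u j) (lyndonWords m e)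
    fun u v h => wordPow_inj hj h]
  congr 1
  ext w
  constructor
  · rintro ⟨⟨⟨hl, hc⟩, hn⟩, hp⟩
    have hw : w = wordPow (w.take m) j := eq_wordPow_take hl hm
      (rotate_eq_self_iff_rotationPeriod_dvd.2 hp.dvd)
    have hlen : (w.take m).length = m := by
      rw [List.length_take, hl]
      exact min_eq_left (Nat.le_mul_of_pos_left m (Nat.pos_of_ne_zero hj))
    refine ⟨w.take m, ⟨⟨hlen, ?_⟩, isLyndon_iff.2 ⟨?_, ?_, ?_⟩⟩, hw.symm⟩
    · rw [hw, count_wordPow] at hc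
      exact Nat.eq_of_mul_eq_mul_left (Nat.pos_of_ne_zero hj) hc
    · rintro h
      rw [h] at hlen
      exact hm hlen.symm
    · rwa [hw, isNecklace_wordPow_iff hj] at hn
    · rw [hlen, ← rotationPeriod_wordPow _ hj, ← hw, hp]
  · rintro ⟨u, ⟨⟨hl, hc⟩, hL⟩, rfl⟩
    obtain ⟨-, hn, hp⟩ := isLyndon_iff.1 hL
    refine ⟨⟨⟨?_, ?_⟩, (isNecklace_wordPow_iff hj).2 hn⟩, ?_⟩
    · rw [length_wordPow, hl]
    · rw [count_wordPow, hc]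
    · rw [rotationPeriod_wordPow _ hj, hp, hl]

theorem length_div_rotationPeriod_dvd_count {w : List (Fin 2)} (hw : w ≠ []) :
    w.length / rotationPeriod w ∣ w.count 1 := by
  have hdvd := rotationPeriod_dvd_length w
  have hp : rotationPeriod w ≠ 0 :=
    (Nat.pos_of_dvd_of_pos hdvd (List.length_pos_iff.2 hw)).ne'
  have := eq_wordPow_take (Nat.div_mul_cancel hdvd).symm hp
    (rotate_eq_self_iff_rotationPeriod_dvd.2 dvd_rfl)
  nth_rw 3 [this]
  rw [count_wordPow]
  exact dvd_mul_right _ _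

/-- A sum over necklaces of a function of the period splits along the exponents of the powers of
Lyndon words that they are. -/
theorem sum_necklaces_eq_sum_divisors (f : ℕ → ℕ) {n : ℕ} (d : ℕ) (hn : n ≠ 0) :
    ∑ w ∈ (necklaces_finite n d).toFinset, f (rotationPeriod w) =
      ∑ j ∈ (n.gcd d).divisors, f (n / j) * numLyndonWords (n / j) (d / j) := by
  classical
  have hg : n.gcd d ≠ 0 := fun h => hn (Nat.gcd_eq_zero_iff.1 h).1
  rw [← Finset.sum_fiberwise_of_maps_to (t := (n.gcd d).divisors)
    (g := fun w => n / rotationPeriod w)]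
  · refine Finset.sum_congr rfl fun j hj => ?_
    have hjg := Nat.dvd_of_mem_divisors hj
    obtain ⟨m, rfl⟩ := hjg.trans (Nat.gcd_dvd_left n d)
    obtain ⟨e, rfl⟩ := hjg.trans (Nat.gcd_dvd_right _ d)
    have hj0 : j ≠ 0 := left_ne_zero_of_mul hn
    have hm0 : m ≠ 0 := right_ne_zero_of_mul hn
    have hj1 := Nat.pos_of_ne_zero hj0
    have hiff : ∀ w ∈ (necklaces_finite (j * m) (j * e)).toFinset,
        (j * m / rotationPeriod w = j ↔ rotationPeriod w = m) := by
      intro w hw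
      have hdvd := rotationPeriod_dvd_length w
      rw [((Set.Finite.mem_toFinset _).1 hw).1.1] at hdvd
      constructor
      · intro h
        have := Nat.div_mul_cancel hdvd
        rw [h] at this
        exact Nat.eq_of_mul_eq_mul_left hj1 this
      · rintro h
        rw [h, Nat.mul_div_cancel _ (Nat.pos_of_ne_zero hm0)]
    rw [Finset.filter_congr hiff, Nat.mul_div_cancel_left _ hj1, Nat.mul_div_cancel_left _ hj1,
      Finset.sum_congr rfl (g := fun _ => f m) fun w hw => by rw [(Finset.mem_filter.1 hw).2],
      Finset.sum_const, smul_eq_mul, mul_comm, ← ncard_necklaces_rotationPeriod hm0 hj0,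
      ← Set.ncard_coe_finset]
    congr 2
    ext w
    simp
  · intro w hw
    obtain ⟨⟨hl, hc⟩, -⟩ := (Set.Finite.mem_toFinset _).1 hw
    rw [Nat.mem_divisors]
    refine ⟨Nat.dvd_gcd (Nat.div_dvd_of_dvd (hl ▸ rotationPeriod_dvd_length w)) ?_, hg⟩
    have := length_div_rotationPeriod_dvd_count (w := w) (by rintro rfl; exact hn hl.symm)
    rwa [hl, hc] at this

theorem choose_eq_sum_numLyndonWords {n : ℕ} (d : ℕ) (hn : n ≠ 0) :
    n.choose d = ∑ j ∈ (n.gcd d).divisors, n / j * numLyndonWords (n / j) (d / j) := by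
  rw [choose_eq_sum_rotationPeriod n d hn, sum_necklaces_eq_sum_divisors (fun p => p) d hn]

theorem numNecklaces_eq_sum_numLyndonWords {n : ℕ} (d : ℕ) (hn : n ≠ 0) :
    numNecklaces n d = ∑ j ∈ (n.gcd d).divisors, numLyndonWords (n / j) (d / j) := by
  have := sum_necklaces_eq_sum_divisors (fun _ => 1) d hn
  simpa [numNecklaces, Set.ncard_eq_toFinset_card _ (necklaces_finite n d)] using this

end Counting

/-! ### Complement symmetry -/

section Identities

theorem sum_divisors_gcd_eq {n d : ℕ} (f : ℕ → ℕ) (hd : d ≠ 0) :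
    ∑ j ∈ (n.gcd d).divisors, f j =
      f 1 + ∑ j ∈ Finset.Icc 2 d, if j ∣ n ∧ j ∣ d then f j else 0 := by
  have hg : n.gcd d ≠ 0 := fun h => hd (Nat.gcd_eq_zero_iff.1 h).2
  rw [← Finset.add_sum_erase _ _ (Nat.one_mem_divisors.2 hg), ← Finset.sum_filter]
  congr 2
  ext j
  simp only [Finset.mem_erase, Nat.mem_divisors, Nat.dvd_gcd_iff, Finset.mem_filter,
    Finset.mem_Icc]
  constructor
  · rintro ⟨h1, h, -⟩
    have h0 : j ≠ 0 := by rintro rfl; exact hd (zero_dvd_iff.1 h.2)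
    exact ⟨⟨by omega, Nat.le_of_dvd (Nat.pos_of_ne_zero hd) h.2⟩, h⟩
  · rintro ⟨⟨h1, -⟩, h⟩
    exact ⟨by omega, h, hg⟩

theorem gcd_sub_self_eq {n d : ℕ} (h : d ≤ n) : n.gcd (n - d) = n.gcd d := by
  obtain ⟨e, rfl⟩ := Nat.exists_eq_add_of_le h
  rw [Nat.add_sub_cancel_left]
  simp [Nat.gcd_comm]

/-- Swapping letters does not send Lyndon words to Lyndon words, so the symmetry is drawn from that
of binomials: in the divisor formula the terms with `j > 1` agree by induction, hence so do those
with `j = 1`. -/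
theorem numLyndonWords_symm {n d : ℕ} (hn : n ≠ 0) (h : d ≤ n) :
    numLyndonWords n (n - d) = numLyndonWords n d := by
  induction n using Nat.strong_induction_on generalizing d with
  | _ n ih =>
    have h1 := choose_eq_sum_numLyndonWords (n - d) hn
    have h2 := choose_eq_sum_numLyndonWords d hn
    have hg : 1 ∈ (n.gcd d).divisors :=
      Nat.one_mem_divisors.2 fun h => hn (Nat.gcd_eq_zero_iff.1 h).1
    rw [Nat.choose_symm h, gcd_sub_self_eq h, h2, ← Finset.add_sum_erase _ _ hg,
      ← Finset.add_sum_erase _ _ hg, Nat.div_one, Nat.div_one, Nat.div_one,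
      Finset.sum_congr rfl (g := fun j => n / j * numLyndonWords (n / j) ((n - d) / j))] at h1
    · exact (Nat.eq_of_mul_eq_mul_left (Nat.pos_of_ne_zero hn) (Nat.add_right_cancel h1)).symm
    · intro j hj
      obtain ⟨hj1, hj⟩ := Finset.mem_erase.1 hj
      have hjg := Nat.dvd_of_mem_divisors hj
      obtain ⟨m, rfl⟩ := hjg.trans (Nat.gcd_dvd_left n d)
      obtain ⟨e, rfl⟩ := hjg.trans (Nat.gcd_dvd_right _ d)
      have hj0 : 0 < j := Nat.pos_of_ne_zero (left_ne_zero_of_mul hn)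
      have hm0 : m ≠ 0 := right_ne_zero_of_mul hn
      rw [← Nat.mul_sub, Nat.mul_div_cancel_left _ hj0, Nat.mul_div_cancel_left _ hj0,
        Nat.mul_div_cancel_left _ hj0, ih m ?_ hm0 (Nat.le_of_mul_le_mul_left h hj0)]
      exact lt_mul_of_one_lt_left (Nat.pos_of_ne_zero hm0) (by omega)

theorem numNecklaces_symm {n d : ℕ} (hn : n ≠ 0) (h : d ≤ n) :
    numNecklaces n (n - d) = numNecklaces n d := by
  rw [numNecklaces_eq_sum_numLyndonWords _ hn, numNecklaces_eq_sum_numLyndonWords _ hn,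
    gcd_sub_self_eq h]
  refine Finset.sum_congr rfl fun j hj => ?_
  have hjg := Nat.dvd_of_mem_divisors hj
  obtain ⟨m, rfl⟩ := hjg.trans (Nat.gcd_dvd_left n d)
  obtain ⟨e, rfl⟩ := hjg.trans (Nat.gcd_dvd_right _ d)
  have hj0 : 0 < j := Nat.pos_of_ne_zero (left_ne_zero_of_mul hn)
  rw [← Nat.mul_sub, Nat.mul_div_cancel_left _ hj0, Nat.mul_div_cancel_left _ hj0,
    Nat.mul_div_cancel_left _ hj0, numLyndonWords_symm (right_ne_zero_of_mul hn)
    (Nat.le_of_mul_le_mul_left h hj0)]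

end Identities

/-! ### Bounding the corrections from proper powers -/

section Bounds

/-- The weighted number of words of length `n / j` and density `d / j`, summed over the common
divisors `j > 1` of `n` and `d`. -/
def properPowerSum (c : ℕ → ℕ) (n d : ℕ) : ℕ :=
  ∑ j ∈ Finset.Icc 2 d, if j ∣ n ∧ j ∣ d then c j * (n / j).choose (d / j) else 0

theorem mul_numLyndonWords_le_choose {n : ℕ} (d : ℕ) (hn : n ≠ 0) :
    n * numLyndonWords n d ≤ n.choose d := by
  have hg : 1 ∈ (n.gcd d).divisors :=
    Nat.one_mem_divisors.2 fun h => hn (Nat.gcd_eq_zero_iff.1 h).1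
  rw [choose_eq_sum_numLyndonWords d hn, ← Finset.add_sum_erase _ _ hg, Nat.div_one, Nat.div_one]
  exact Nat.le_add_right _ _

theorem choose_le_mul_numLyndonWords_add {n d : ℕ} (hn : n ≠ 0) (hd : d ≠ 0) :
    n.choose d ≤ n * numLyndonWords n d + properPowerSum (fun _ => 1) n d := by
  rw [choose_eq_sum_numLyndonWords d hn, sum_divisors_gcd_eq _ hd, Nat.div_one, Nat.div_one]
  refine Nat.add_le_add_left (Finset.sum_le_sum fun j hj => ?_) _
  split_ifs with h
  · rw [one_mul]
    refine mul_numLyndonWords_le_choose _ fun h0 => hn ?_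
    rw [← Nat.div_mul_cancel h.1, h0, zero_mul]
  · rfl

/-- Exponent `j` contributes `n * L` on the left but only `(n / j) * L` to the binomial; the excess
is `(j - 1) * (n / j) * L`. -/
theorem mul_numNecklaces_le {n d : ℕ} (hn : n ≠ 0) (hd : d ≠ 0) :
    n * numNecklaces n d ≤ n.choose d + properPowerSum (fun j => j - 1) n d := by
  rw [choose_eq_sum_numLyndonWords d hn, numNecklaces_eq_sum_numLyndonWords d hn,
    sum_divisors_gcd_eq _ hd, sum_divisors_gcd_eq _ hd, Nat.div_one, Nat.div_one, mul_add, add_assoc,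
    properPowerSum, ← Finset.sum_add_distrib, Finset.mul_sum]
  refine Nat.add_le_add_left (Finset.sum_le_sum fun j hj => ?_) _
  split_ifs with h
  · obtain ⟨⟨m, rfl⟩, -⟩ := h
    have hj2 := (Finset.mem_Icc.1 hj).1
    rw [Nat.mul_div_cancel_left _ (by omega)]
    have := Nat.mul_le_mul_left (j - 1)
      (mul_numLyndonWords_le_choose (d / j) (right_ne_zero_of_mul hn))
    obtain ⟨i, rfl⟩ := Nat.exists_eq_add_of_le' (show 1 ≤ j by omega)
    rw [Nat.add_sub_cancel] at this ⊢
    linarith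
  · simp

theorem numNecklaces_lt_of_properPowerSum_lt {n d : ℕ} (hn : 1 < n) (hd : 1 < d)
    (h : (n - 1) * properPowerSum (fun j => j - 1) n d +
      n * (properPowerSum (fun _ => 1) (n - 1) d + properPowerSum (fun _ => 1) (n - 1) (d - 1)) <
        n.choose d) :
    numNecklaces n d < numLyndonWords (n - 1) d + numLyndonWords (n - 1) (d - 1) := by
  obtain ⟨m, rfl⟩ := Nat.exists_eq_add_of_le' hn.le
  obtain ⟨e, rfl⟩ := Nat.exists_eq_add_of_le' hd.le
  rw [Nat.add_sub_cancel, Nat.add_sub_cancel] at *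
  have hm : m ≠ 0 := by omega
  have h1 := mul_numNecklaces_le (n := m + 1) (d := e + 1) (by omega) (by omega)
  have h2 := choose_le_mul_numLyndonWords_add (n := m) (d := e + 1) hm (by omega)
  have h3 := choose_le_mul_numLyndonWords_add (n := m) (d := e) hm (by omega)
  have h4 := Nat.choose_succ_succ' m e
  have hlt : m * ((m + 1) * numNecklaces (m + 1) (e + 1)) <
      m * ((m + 1) * (numLyndonWords m (e + 1) + numLyndonWords m e)) := by
    have h5 := Nat.mul_le_mul_left m h1
    have h6 := Nat.mul_le_mul_left (m + 1) (Nat.add_le_add h2 h3)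
    rw [add_comm (m.choose _), ← h4] at h6
    nlinarith
  exact Nat.lt_of_mul_lt_mul_left (Nat.lt_of_mul_lt_mul_left hlt)

/-- Division by `j ≥ 2` leaves at most `a` ones and `b` zeros, and C(p+q, p) is monotone in `p` and
`q`. -/
theorem choose_div_le_choose_add {a b j m e : ℕ} (hj : 2 ≤ j) (hm : j ∣ m) (he : j ∣ e)
    (ha : e ≤ 2 * a + 1) (hb : m ≤ e + 2 * b + 1) :
    (m / j).choose (e / j) ≤ (a + b).choose a := by
  obtain ⟨m, rfl⟩ := hm
  obtain ⟨e, rfl⟩ := he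
  rw [Nat.mul_div_cancel_left _ (by omega), Nat.mul_div_cancel_left _ (by omega)]
  rcases lt_or_ge m e with hlt | hle
  · rw [Nat.choose_eq_zero_of_lt hlt]
    exact Nat.zero_le _
  obtain ⟨f, rfl⟩ := Nat.exists_eq_add_of_le hle
  have hea : e ≤ a := by nlinarith
  have hfb : f ≤ b := by nlinarith
  calc (e + f).choose e = (e + f).choose f := by rw [Nat.choose_symm_add]
    _ ≤ (a + f).choose f := Nat.choose_le_choose _ (by omega)
    _ = (a + f).choose a := by rw [Nat.choose_symm_add]
    _ ≤ (a + b).choose a := Nat.choose_le_choose _ (by omega)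

theorem properPowerSum_le {a b n d : ℕ} (c : ℕ → ℕ) (ha : d ≤ 2 * a + 1)
    (hb : n ≤ d + 2 * b + 1) :
    properPowerSum c n d ≤ (∑ j ∈ Finset.Icc 2 d, c j) * (a + b).choose a := by
  rw [properPowerSum, Finset.sum_mul]
  refine Finset.sum_le_sum fun j hj => ?_
  split_ifs with h
  · exact Nat.mul_le_mul_left _
      (choose_div_le_choose_add (Finset.mem_Icc.1 hj).1 h.1 h.2 ha hb)
  · exact Nat.zero_le _

theorem two_mul_sum_Icc_pred (d : ℕ) :
    2 * ∑ j ∈ Finset.Icc 2 (d + 1), (j - 1) = (d + 1) * d := by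
  induction d with
  | zero => simp
  | succ d ih =>
    rw [Finset.sum_Icc_succ_top (by omega), mul_add, ih, Nat.add_sub_cancel]
    ring

/-- The quotient of `2a + 2b` choose `2a` by `a + b` choose `a`. -/
def chooseRatio (a b : ℕ) : ℚ := (2 * a + 2 * b).choose (2 * a) / (a + b).choose a

theorem chooseRatio_zero (b : ℕ) : chooseRatio 0 b = 1 := by simp [chooseRatio]

/-- For fixed `a` the ratio is thus a product of `a` linear factors in `b`, each at least 1. -/
theorem chooseRatio_succ (a b : ℕ) :
    chooseRatio (a + 1) b = chooseRatio a b * (2 * b + 2 * a + 1) / (2 * a + 1) := by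
  have h1 := Nat.add_one_mul_choose_eq (2 * a + 2 * b) (2 * a)
  have h2 := Nat.add_one_mul_choose_eq (2 * a + 2 * b + 1) (2 * a + 1)
  have h3 := Nat.add_one_mul_choose_eq (a + b) a
  have h4 : ((a + b).choose a : ℚ) ≠ 0 :=
    Nat.cast_ne_zero.2 (Nat.choose_pos (by omega)).ne'
  have h5 : ((a + b + 1).choose (a + 1) : ℚ) ≠ 0 :=
    Nat.cast_ne_zero.2 (Nat.choose_pos (by omega)).ne'
  have e1 : (2 * (a + 1) + 2 * b) = 2 * a + 2 * b + 1 + 1 := by ring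
  have e2 : a + 1 + b = a + b + 1 := by ring
  have e3 : 2 * (a + 1) = 2 * a + 1 + 1 := by ring
  rw [chooseRatio, chooseRatio, e1, e2, e3]
  have a1 : (2 * (a : ℚ) + 1) ≠ 0 := by positivity
  have a2 : ((a : ℚ) + 1) ≠ 0 := by positivity
  have a3 : ((a : ℚ) + b + 1) ≠ 0 := by positivity
  have g1 : ((2 * a + 2 * b + 1).choose (2 * a + 1) : ℚ) =
      (2 * a + 2 * b + 1) * (2 * a + 2 * b).choose (2 * a) / (2 * a + 1) := by
    rw [eq_div_iff a1]; exact_mod_cast h1.symm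
  have g2 : ((2 * a + 2 * b + 1 + 1).choose (2 * a + 1 + 1) : ℚ) =
      (2 * (a + b + 1)) * (2 * a + 2 * b + 1).choose (2 * a + 1) / (2 * (a + 1)) := by
    rw [eq_div_iff (by positivity)]; norm_cast; linarith
  have g3 : ((a + b + 1).choose (a + 1) : ℚ) = (a + b + 1) * (a + b).choose a / (a + 1) := by
    rw [eq_div_iff a2]; exact_mod_cast h3.symm
  rw [g2, g1, g3]
  field_simp
  ring

theorem chooseRatio_mono_left {a a' b : ℕ} (h : a ≤ a') : chooseRatio a b ≤ chooseRatio a' b := by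
  refine monotone_nat_of_le_succ (f := fun a => chooseRatio a b) (fun a => ?_) h
  simp only [chooseRatio_succ]
  rw [le_div_iff₀ (by positivity)]
  refine mul_le_mul_of_nonneg_left ?_ (by rw [chooseRatio]; positivity)
  linarith [(Nat.cast_nonneg b : (0 : ℚ) ≤ b)]

/-- For `a < 6` this compares polynomials in `b`. For larger `a`, the right side is lowered to `a =
6` and the left raised to `a = b`, leaving degree 6 against a cubic. The threshold 30 is sharp for
`a = 2`. -/
theorem lt_chooseRatio {a b : ℕ} (ha : 2 ≤ a) (hab : a ≤ b) (h : 30 ≤ a + b) :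
    ((a : ℚ) + b + 1) * (4 * a ^ 2 + 10 * a) < chooseRatio a b := by
  rcases lt_or_ge a 6 with h6 | h6
  · obtain ⟨x, rfl⟩ := Nat.exists_eq_add_of_le (show 25 ≤ b by omega)
    interval_cases a
    · obtain ⟨x, rfl⟩ := Nat.exists_eq_add_of_le (show 3 ≤ x by omega)
      simp only [chooseRatio_succ, chooseRatio_zero]
      push_cast
      rw [← sub_pos]
      ring_nf
      positivity
    all_goals
      simp only [chooseRatio_succ, chooseRatio_zero]
      push_cast
      rw [← sub_pos]
      ring_nf
      positivity
  · refine lt_of_lt_of_le ?_ (chooseRatio_mono_left h6)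
    have hab' : (a : ℚ) ≤ b := by exact_mod_cast hab
    refine lt_of_le_of_lt (b := ((b : ℚ) + b + 1) * (4 * b ^ 2 + 10 * b)) (by gcongr) ?_
    obtain ⟨x, rfl⟩ := Nat.exists_eq_add_of_le (show 15 ≤ b by omega)
    simp only [chooseRatio_succ, chooseRatio_zero]
    push_cast
    rw [← sub_pos]
    ring_nf
    positivity

theorem properPowerSum_lt_of_large {n d : ℕ} (hd : 4 ≤ d) (hdn : 2 * d ≤ n) (hn : 62 ≤ n) :
    (n - 1) * properPowerSum (fun j => j - 1) n d +
      n * (properPowerSum (fun _ => 1) (n - 1) d + properPowerSum (fun _ => 1) (n - 1) (d - 1)) <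
        n.choose d := by
  obtain ⟨a, ha, ha'⟩ : ∃ a, 2 * a ≤ d ∧ d ≤ 2 * a + 1 := ⟨d / 2, by omega, by omega⟩
  obtain ⟨b, hb, hb'⟩ : ∃ b, d + 2 * b ≤ n ∧ n ≤ d + 2 * b + 1 :=
    ⟨(n - d) / 2, by omega, by omega⟩
  have h1 := properPowerSum_le (a := a) (b := b) (n := n) (d := d) (fun j => j - 1) ha' hb'
  have h2 := properPowerSum_le (a := a) (b := b) (n := n - 1) (d := d) (fun _ => 1)
    ha' (by omega)
  have h3 := properPowerSum_le (a := a) (b := b) (n := n - 1) (d := d - 1) (fun _ => 1)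
    (by omega) (by omega)
  have hratio := lt_chooseRatio (a := a) (b := b) (by omega) (by omega) (by omega)
  have hS : 0 < (a + b).choose a := Nat.choose_pos (by omega)
  rw [chooseRatio, lt_div_iff₀ (by exact_mod_cast hS)] at hratio
  have hratio' : (a + b + 1) * (4 * a ^ 2 + 10 * a) * (a + b).choose a <
      (2 * a + 2 * b).choose (2 * a) := by exact_mod_cast hratio
  have hC : (2 * a + 2 * b).choose (2 * a) ≤ n.choose d := by
    obtain ⟨e, rfl⟩ := Nat.exists_eq_add_of_le (show d ≤ n by omega)
    calc (2 * a + 2 * b).choose (2 * a) = (2 * a + 2 * b).choose (2 * b) := by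
          rw [Nat.choose_symm_add]
      _ ≤ (d + 2 * b).choose (2 * b) := Nat.choose_le_choose _ (by omega)
      _ = (d + 2 * b).choose d := by rw [Nat.choose_symm_add]
      _ ≤ (d + e).choose d := Nat.choose_le_choose _ (by omega)
  refine lt_of_le_of_lt ?_ (hratio'.trans_le hC)
  obtain ⟨e, rfl⟩ := Nat.exists_eq_add_of_le' (show 2 ≤ d by omega)
  have hsum := two_mul_sum_Icc_pred (e + 1)
  simp only [Finset.sum_const, Nat.card_Icc, smul_eq_mul, mul_one] at h2 h3
  generalize ∑ j ∈ Finset.Icc 2 (e + 2), (j - 1) = T at *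
  generalize (a + b).choose a = S at *
  -- With `d = e + 2`, the doubled sum is d² + 3d - 6, and `d ≤ 2 * a + 1` gives the quadratic in
  -- `a`.
  have hcoef : n * T + n * ((e + 1) + e) ≤ (a + b + 1) * (4 * a ^ 2 + 10 * a) := by
    have hn2 : n ≤ 2 * (a + b + 1) := by omega
    have hT : 2 * (T + ((e + 1) + e)) ≤ 4 * a ^ 2 + 10 * a := by nlinarith
    nlinarith [Nat.mul_le_mul hn2 hT]
  calc _ ≤ n * (T * S) + n * ((e + 1) * S + e * S) := by
        gcongr
        · omega
        · exact h2
        · exact h3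
    _ = (n * T + n * ((e + 1) + e)) * S := by ring
    _ ≤ _ := Nat.mul_le_mul_right _ hcoef

theorem properPowerSum_lt_of_small {n d : ℕ} (hd : 4 ≤ d) (hdn : 2 * d ≤ n) (h9 : 9 ≤ n)
    (hn : n < 62) :
    (n - 1) * properPowerSum (fun j => j - 1) n d +
      n * (properPowerSum (fun _ => 1) (n - 1) d + properPowerSum (fun _ => 1) (n - 1) (d - 1)) <
        n.choose d := by
  have key : ∀ n < 62, 9 ≤ n → ∀ d < 31, 4 ≤ d → 2 * d ≤ n →
      (n - 1) * properPowerSum (fun j => j - 1) n d +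
        n * (properPowerSum (fun _ => 1) (n - 1) d +
          properPowerSum (fun _ => 1) (n - 1) (d - 1)) < n.choose d := by
    -- Factorial quotients avoid the branching Pascal recursion during evaluation.
    simp only [properPowerSum, Nat.choose_eq_descFactorial_div_factorial]
    decide +kernel
  exact key n hn h9 d (by omega) hd hdn

theorem properPowerSum_three_lt {n : ℕ} (hn : 10 ≤ n) :
    (n - 1) * properPowerSum (fun j => j - 1) n 3 +
      n * (properPowerSum (fun _ => 1) (n - 1) 3 + properPowerSum (fun _ => 1) (n - 1) (3 - 1)) <
        n.choose 3 := by
  have e3 : Finset.Icc 2 3 = {2, 3} := rfl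
  have e2 : Finset.Icc 2 2 = {2} := rfl
  obtain ⟨m, rfl⟩ := Nat.exists_eq_add_of_le' (show 1 ≤ n by omega)
  have hc := Nat.add_one_mul_choose_eq m 2
  have hc' := Nat.add_one_mul_choose_eq (m - 1) 1
  rw [Nat.sub_add_cancel (by omega), Nat.choose_one_right] at hc'
  simp only [Nat.reduceAdd] at hc hc'
  have a3 : properPowerSum (fun j => j - 1) (m + 1) 3 ≤ if 3 ∣ m + 1 then 2 * ((m + 1) / 3) else 0 := by
    simp [properPowerSum, e3]
  have b3 : properPowerSum (fun _ => 1) m 3 ≤ if 3 ∣ m then m / 3 else 0 := by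
    simp [properPowerSum, e3]
  have b2 : properPowerSum (fun _ => 1) m 2 ≤ m / 2 := by
    simp only [properPowerSum, e2, Finset.sum_singleton]
    split_ifs <;> simp
  simp only [Nat.add_sub_cancel, Nat.reduceSub]
  -- Since 3 cannot divide both `m` and `m + 1`, the worst case is 2/3 + 1/2 = 7/6. Against C(n,3) =
  -- n(n-1)(n-2)/6 this needs n - 2 > 7, whence `10 ≤ n`.
  have hkey : 6 * (m * properPowerSum (fun j => j - 1) (m + 1) 3 +
      (m + 1) * (properPowerSum (fun _ => 1) m 3 + properPowerSum (fun _ => 1) m 2)) ≤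
        7 * (m * (m + 1)) := by
    have b2' : 2 * properPowerSum (fun _ => 1) m 2 ≤ m := by omega
    by_cases h : 3 ∣ m + 1
    · rw [if_pos h] at a3
      rw [if_neg (by omega)] at b3
      have a3' : 3 * properPowerSum (fun j => j - 1) (m + 1) 3 ≤ 2 * (m + 1) := by omega
      rw [Nat.le_zero.1 b3]
      nlinarith
    · rw [if_neg h] at a3
      have b3' : 3 * properPowerSum (fun _ => 1) m 3 ≤ m := by
        split_ifs at b3 <;> omega
      rw [Nat.le_zero.1 a3]
      nlinarith
  have hC : 6 * (m + 1).choose 3 = (m + 1) * (m * (m - 1)) := by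
    rw [hc']; linarith
  obtain ⟨k, rfl⟩ := Nat.exists_eq_add_of_le' (show 1 ≤ m by omega)
  rw [Nat.add_sub_cancel] at hC
  nlinarith

end Bounds

/-! ### The exceptional pairs -/

section SmallCases

theorem numLyndonWords_of_coprime {n d : ℕ} (hn : n ≠ 0) (h : n.Coprime d) :
    n * numLyndonWords n d = n.choose d := by
  rw [choose_eq_sum_numLyndonWords d hn, Nat.Coprime.gcd_eq_one h]
  simp

theorem numLyndonWords_two_one : numLyndonWords 2 1 = 1 := by
  have := numLyndonWords_of_coprime (n := 2) (d := 1) (by decide) (by decide)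
  simp only [Nat.choose_one_right] at this
  omega

theorem numLyndonWords_three_one : numLyndonWords 3 1 = 1 := by
  have := numLyndonWords_of_coprime (n := 3) (d := 1) (by decide) (by decide)
  simp only [Nat.choose_one_right] at this
  omega

theorem numLyndonWords_four_one : numLyndonWords 4 1 = 1 := by
  have := numLyndonWords_of_coprime (n := 4) (d := 1) (by decide) (by decide)
  simp only [Nat.choose_one_right] at this
  omega

theorem numLyndonWords_six_three : numLyndonWords 6 3 = 3 := by
  have := choose_eq_sum_numLyndonWords (n := 6) 3 (by decide)
  rw [show (Nat.gcd 6 3).divisors = {1, 3} by decide, show Nat.choose 6 3 = 20 by decide] at this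
  simp [numLyndonWords_two_one] at this
  omega

theorem numNecklaces_six_three :
    numNecklaces 6 3 = numLyndonWords 5 3 + numLyndonWords 5 2 := by
  have h1 := numLyndonWords_of_coprime (n := 5) (d := 3) (by decide) (by decide)
  have h2 := numLyndonWords_of_coprime (n := 5) (d := 2) (by decide) (by decide)
  rw [show Nat.choose 5 3 = 10 by decide] at h1
  rw [show Nat.choose 5 2 = 10 by decide] at h2
  rw [numNecklaces_eq_sum_numLyndonWords 3 (by decide),
    show (Nat.gcd 6 3).divisors = {1, 3} by decide]
  simp [numLyndonWords_two_one, numLyndonWords_six_three]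
  omega

theorem numNecklaces_seven_three :
    numNecklaces 7 3 = numLyndonWords 6 3 + numLyndonWords 6 2 := by
  have h1 := numLyndonWords_of_coprime (n := 7) (d := 3) (by decide) (by decide)
  have h2 := choose_eq_sum_numLyndonWords (n := 6) 2 (by decide)
  rw [show Nat.choose 7 3 = 35 by decide] at h1
  rw [show (Nat.gcd 6 2).divisors = {1, 2} by decide, show Nat.choose 6 2 = 15 by decide] at h2
  rw [numNecklaces_eq_sum_numLyndonWords 3 (by decide),
    show (Nat.gcd 7 3).divisors = {1} by decide]
  simp [numLyndonWords_three_one, numLyndonWords_six_three] at h2 ⊢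
  omega

theorem numNecklaces_eight_four :
    numNecklaces 8 4 = numLyndonWords 7 4 + numLyndonWords 7 3 := by
  have h1 := numLyndonWords_of_coprime (n := 7) (d := 4) (by decide) (by decide)
  have h2 := numLyndonWords_of_coprime (n := 7) (d := 3) (by decide) (by decide)
  have h3 := choose_eq_sum_numLyndonWords (n := 4) 2 (by decide)
  have h4 := choose_eq_sum_numLyndonWords (n := 8) 4 (by decide)
  rw [show Nat.choose 7 4 = 35 by decide] at h1
  rw [show Nat.choose 7 3 = 35 by decide] at h2
  rw [show (Nat.gcd 4 2).divisors = {1, 2} by decide, show Nat.choose 4 2 = 6 by decide] at h3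
  rw [show (Nat.gcd 8 4).divisors = {1, 2, 4} by decide,
    show Nat.choose 8 4 = 70 by decide] at h4
  rw [numNecklaces_eq_sum_numLyndonWords 4 (by decide),
    show (Nat.gcd 8 4).divisors = {1, 2, 4} by decide]
  simp [numLyndonWords_two_one] at h3 h4 ⊢
  omega

theorem numNecklaces_nine_three :
    numNecklaces 9 3 = numLyndonWords 8 3 + numLyndonWords 8 2 := by
  have h1 := numLyndonWords_of_coprime (n := 8) (d := 3) (by decide) (by decide)
  have h2 := choose_eq_sum_numLyndonWords (n := 8) 2 (by decide)
  have h3 := choose_eq_sum_numLyndonWords (n := 9) 3 (by decide)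
  rw [show Nat.choose 8 3 = 56 by decide] at h1
  rw [show (Nat.gcd 8 2).divisors = {1, 2} by decide, show Nat.choose 8 2 = 28 by decide] at h2
  rw [show (Nat.gcd 9 3).divisors = {1, 3} by decide, show Nat.choose 9 3 = 84 by decide] at h3
  rw [numNecklaces_eq_sum_numLyndonWords 3 (by decide),
    show (Nat.gcd 9 3).divisors = {1, 3} by decide]
  simp [numLyndonWords_four_one, numLyndonWords_three_one] at h2 h3 ⊢
  omega

end SmallCases

/-! ### Assembly of the cases -/

theorem numNecklaces_eq_iff_of_two_mul_le {n d : ℕ} (hd : 2 < d) (hdn : 2 * d ≤ n) :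
    numNecklaces n d = numLyndonWords (n - 1) d + numLyndonWords (n - 1) (d - 1) ↔
      (n, d) ∈ ({(6, 3), (7, 3), (8, 4), (9, 3)} : Set (ℕ × ℕ)) := by
  simp only [Set.mem_insert_iff, Set.mem_singleton_iff, Prod.mk.injEq]
  constructor
  · intro h
    by_contra hne
    refine (numNecklaces_lt_of_properPowerSum_lt (n := n) (d := d) (by omega) (by omega) ?_).ne h
    rcases lt_or_ge n 62 with hn | hn
    · rcases lt_or_ge 3 d with h3 | h3
      · exact properPowerSum_lt_of_small h3 hdn (by omega) hn
      · obtain rfl : d = 3 := by omega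
        rcases lt_or_ge n 10 with h10 | h10
        · obtain rfl : n = 8 := by omega
          -- At (8, 3) all corrections vanish by coprimality.
          decide
        · exact properPowerSum_three_lt h10
    · rcases lt_or_ge 3 d with h3 | h3
      · exact properPowerSum_lt_of_large h3 hdn hn
      · obtain rfl : d = 3 := by omega
        exact properPowerSum_three_lt (by omega)
  · rintro (⟨rfl, rfl⟩ | ⟨rfl, rfl⟩ | ⟨rfl, rfl⟩ | ⟨rfl, rfl⟩)
    · exact numNecklaces_six_three
    · exact numNecklaces_seven_three
    · exact numNecklaces_eight_four
    · exact numNecklaces_nine_three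

theorem mainTheorem4 (n d : ℕ) (hd : 2 < d) (hdn : d < n - 2) :
    numNecklaces n d = numLyndonWords (n - 1) d + numLyndonWords (n - 1) (d - 1) ↔
      (n, d) ∈ ({(6, 3), (7, 3), (7, 4), (8, 4), (9, 3), (9, 6)} : Set (ℕ × ℕ)) := by
  rcases le_or_gt (2 * d) n with h | h
  · rw [numNecklaces_eq_iff_of_two_mul_le hd h]
    simp only [Set.mem_insert_iff, Set.mem_singleton_iff, Prod.mk.injEq]
    omega
  · have h1 := numNecklaces_symm (n := n) (d := d) (by omega) (by omega)
    have h2 := numLyndonWords_symm (n := n - 1) (d := d) (by omega) (by omega)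
    have h3 := numLyndonWords_symm (n := n - 1) (d := d - 1) (by omega) (by omega)
    -- Complementation exchanges the two Lyndon terms, hence `add_comm`.
    rw [← h1, ← h2, ← h3, add_comm, show n - 1 - d = n - d - 1 by omega,
      show n - 1 - (d - 1) = n - d by omega,
      numNecklaces_eq_iff_of_two_mul_le (by omega) (by omega)]
    simp only [Set.mem_insert_iff, Set.mem_singleton_iff, Prod.mk.injEq]
    omega
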